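/- For a finite simple graph $G$ with Laplacian matrix $L_G=D_G-A_G$ put $U_{L_G}(t)=\exp(-\mathrm{i}tL_G)$ for $t\in\mathbb{R}$. For distinct vertices $a,b$ of $G$, the vector $\mathbf e_a-\mathbf e_b$ is the pair state of $\{a,b\}$ (it is regarded as determined by the unordered pair $\{a,b\}$, i.e. up to sign). The graph $G$ has Laplacian perfect pair state transfer if there are two distinct pair states $\mathbf e_a-\mathbf e_b$ and $\mathbf e_c-\mathbf e_d$ (that is, $a\neq b$, $c\neq d$ and $\{a,b\}\neq\{c,d\}$), a time $\tau\in\mathbb{R}$ and a complex number $\chi$ with $|\chi|=1$ such that $$U_{L_G}(\tau)(\mathbf e_a-\mathbf e_b)=\chi\,(\mathbf e_c-\mathbf e_d).$$ The Q-graph $\mathcal Q(G)$ is the graph obtained from $G$ by inserting a new vertex into each edge of $G$ and joining by edges those pairs of new vertices that lie on adjacent edges of $G$ (edges with a common endpoint). Let $K_n$ be the complete graph on $n\ge 4$ vertices. Then $\mathcal Q(K_n)$ does not have Laplacian perfect pair state transfer. -/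

import Mathlib

open scoped Matrix

namespace SimpleGraph

variable {V : Type*}

/-- The Q-graph of `G`: its vertices are the vertices of `G` together with one new vertex for each
edge of `G`. A vertex of `G` is joined to the new vertices of the edges containing it (and to no
other vertex of `G`), and two distinct new vertices are joined when their edges share an endpoint. -/
def qGraph (G : SimpleGraph V) : SimpleGraph (V ⊕ G.edgeSet) where
  Adj
    | .inl _, .inl _ => False
    | .inl v, .inr e => v ∈ (e : Sym2 V)
    | .inr e, .inl v => v ∈ (e : Sym2 V)
    | .inr e, .inr f => e ≠ f ∧ ∃ v : V, v ∈ (e : Sym2 V) ∧ v ∈ (f : Sym2 V)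
  symm := ⟨by
    rintro (u | e) (v | f) h
    · exact h
    · exact h
    · exact h
    · exact ⟨h.1.symm, h.2.imp fun _ hv => ⟨hv.2, hv.1⟩⟩⟩
  loopless := ⟨by
    rintro (u | e) h
    · exact h
    · exact h.1 rfl⟩

instance qGraph.decidableRelAdj [Fintype V] [DecidableEq V] (G : SimpleGraph V) :
    DecidableRel G.qGraph.Adj
  | .inl _, .inl _ => inferInstanceAs (Decidable False)
  | .inl v, .inr e => inferInstanceAs (Decidable (v ∈ (e : Sym2 V)))
  | .inr e, .inl v => inferInstanceAs (Decidable (v ∈ (e : Sym2 V)))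
  | .inr e, .inr f => inferInstanceAs
      (Decidable (e ≠ f ∧ ∃ v : V, v ∈ (e : Sym2 V) ∧ v ∈ (f : Sym2 V)))

/-- The transition matrix `exp (-i t L)` of `G` relative to its Laplacian matrix `L`. -/
noncomputable def lapTransitionMatrix [Fintype V] [DecidableEq V] (G : SimpleGraph V)
    [DecidableRel G.Adj] (t : ℝ) : Matrix V V ℂ :=
  NormedSpace.exp ((-(Complex.I * (t : ℂ))) • G.lapMatrix ℂ)

/-- The vector `e_a - e_b`, which is the pair state of `{a, b}` when `a ≠ b`. -/
def pairState [DecidableEq V] (a b : V) : V → ℂ :=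
  Pi.single a 1 - Pi.single b 1

/-- Laplacian perfect pair state transfer between `e_a - e_b` and `e_c - e_d` at time `τ`. The pair
states must be distinct; the pair state of `{a, b}` is determined only up to sign, so this means
that the unordered pairs `{a, b}` and `{c, d}` differ. -/
def HasPairLPSTAt [Fintype V] [DecidableEq V] (G : SimpleGraph V) [DecidableRel G.Adj]
    (a b c d : V) (τ : ℝ) : Prop :=
  a ≠ b ∧ c ≠ d ∧ s(a, b) ≠ s(c, d) ∧
    ∃ χ : ℂ, ‖χ‖ = 1 ∧ G.lapTransitionMatrix τ *ᵥ pairState a b = χ • pairState c d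

/-- `G` has Laplacian perfect pair state transfer between some two distinct pair states, at some
time. -/
def HasPairLPST [Fintype V] [DecidableEq V] (G : SimpleGraph V) [DecidableRel G.Adj] : Prop :=
  ∃ (a b c d : V) (τ : ℝ), G.HasPairLPSTAt a b c d τ

end SimpleGraph

/-!
Pairing the transfer equation `U(τ) (e_a - e_b) = χ (e_c - e_d)` with a Laplacian eigenvector `f` of
eigenvalue `l` gives `exp (-iτl) (f a - f b) = χ (f c - f d)` (`isSpectralTransfer_of_mulVec`), so
everything reduces to explicit eigenvectors of `Q(K_n)`:

* a vector constant on each vertex class, with eigenvalue `n + 1`;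
* for each `z` of sum zero, the vectors with entries `m z_i` at vertices and `z_i + z_j` at edges,
  where `m² = 3m + n - 2`, with eigenvalue `n + 2 - m`;
* alternating weights on the edges of a 4-cycle, with eigenvalue `2n`.

The first shows that a pair of one vertex and one edge of `K_n` can only be sent to such a pair. On
the second family, the standard part, the transition matrix acts as a polynomial `p + q M` in a
2 × 2 matrix `M` with nonzero off-diagonal entries; comparing coordinates
(`IsSpectralTransfer.standard`) settles pairs of vertices and vertex-edge pairs, whatever the
eigenvalues are. For pairs of edges it forces `q = 0`, and the source and target to be `ab, ad` and
`xb, xd`. A 4-cycle through `a, b, d` and a further vertex other than `x` contradicts this when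
`n ≥ 5`. When `n = 4` it remains to exclude equal phases at the eigenvalues `(9 ± √17) / 2` together
with the opposite phase at `8`, which the irrationality of `√17` does. A pair of vertices cannot go
to a pair of edges because some 4-cycle passes through one edge and not the other.
-/

namespace SimpleGraph

/-! ### Transfer of pair states tested on Laplacian eigenvectors -/

section Transfer
variable {V : Type*} [Fintype V] [DecidableEq V]

theorem exp_mulVec_of_mulVec_eq_smul {M : Matrix V V ℂ} {f : V → ℂ} {μ : ℂ}
    (h : M *ᵥ f = μ • f) : NormedSpace.exp M *ᵥ f = Complex.exp μ • f := by
  let _ : NormedRing (Matrix V V ℂ) := Matrix.linftyOpNormedRing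
  let _ : NormedAlgebra ℂ (Matrix V V ℂ) := Matrix.linftyOpNormedAlgebra
  have hpow : ∀ k : ℕ, (M ^ k) *ᵥ f = μ ^ k • f := by
    intro k
    induction k with
    | zero => simp
    | succ k ih => rw [pow_succ, ← Matrix.mulVec_mulVec, h, Matrix.mulVec_smul, ih, smul_smul,
        pow_succ']
  have h1 : HasSum (fun k : ℕ => ((k.factorial : ℂ)⁻¹ • M ^ k) *ᵥ f) (NormedSpace.exp M *ᵥ f) :=
    (NormedSpace.exp_series_hasSum_exp' (𝕂 := ℂ) M).map
      (Matrix.mulVec.addMonoidHomLeft f) (continuous_id.matrix_mulVec continuous_const)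
  have h2 : HasSum (fun k : ℕ => ((k.factorial : ℂ)⁻¹ • μ ^ k) • f) (Complex.exp μ • f) := by
    rw [Complex.exp_eq_exp_ℂ]
    exact (NormedSpace.exp_series_hasSum_exp' (𝕂 := ℂ) μ).smul_const f
  refine h1.unique ?_
  convert h2 using 2 with k
  rw [Matrix.smul_mulVec, hpow, smul_smul, smul_eq_mul]

theorem lapMatrix_mulVec_eq_sum (G : SimpleGraph V) [DecidableRel G.Adj] (f : V → ℂ) (i : V) :
    (G.lapMatrix ℂ *ᵥ f) i = ∑ j, if G.Adj i j then f i - f j else 0 := by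
  rw [lapMatrix_mulVec_apply, ← Finset.sum_filter, ← neighborFinset_eq_filter]
  simp

theorem lapTransitionMatrix_dotProduct (G : SimpleGraph V) [DecidableRel G.Adj] {f : V → ℂ}
    {l : ℂ} (h : G.lapMatrix ℂ *ᵥ f = l • f) (t : ℝ) (u : V → ℂ) :
    f ⬝ᵥ (G.lapTransitionMatrix t *ᵥ u) = Complex.exp (-(Complex.I * t * l)) * (f ⬝ᵥ u) := by
  have hs : (G.lapTransitionMatrix t).IsSymm :=
    ((G.isSymm_lapMatrix (R := ℂ)).smul _).exp
  have he : G.lapTransitionMatrix t *ᵥ f = Complex.exp (-(Complex.I * t * l)) • f := by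
    apply exp_mulVec_of_mulVec_eq_smul
    rw [Matrix.smul_mulVec, h, smul_smul, neg_mul]
  rw [Matrix.dotProduct_mulVec, ← Matrix.mulVec_transpose, hs.eq, he, smul_dotProduct, smul_eq_mul]

/-- Transfer of the pair state of `a`, `b` to that of `c`, `d` with phase `χ`, tested on every
Laplacian eigenvector `f`: pairing `U(τ) (e_a - e_b) = χ (e_c - e_d)` with `f` gives
`exp (-iτl) (f a - f b) = χ (f c - f d)`. The eigenvectors span the whole space, so no information
is lost, and each eigenvector yields one scalar equation. -/
def IsSpectralTransfer (G : SimpleGraph V) [DecidableRel G.Adj] (a b c d : V) (τ : ℝ) (χ : ℂ) :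
    Prop :=
  ∀ (f : V → ℂ) (l : ℂ), G.lapMatrix ℂ *ᵥ f = l • f →
    Complex.exp (-(Complex.I * τ * l)) * (f a - f b) = χ * (f c - f d)

theorem dotProduct_pairState (f : V → ℂ) (a b : V) : f ⬝ᵥ pairState a b = f a - f b := by
  simp [pairState, dotProduct_sub]

variable {G : SimpleGraph V} [DecidableRel G.Adj] {a b c d : V} {τ : ℝ} {χ : ℂ}

theorem isSpectralTransfer_of_mulVec
    (h : G.lapTransitionMatrix τ *ᵥ pairState a b = χ • pairState c d) :
    G.IsSpectralTransfer a b c d τ χ := by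
  intro f l hf
  rw [← dotProduct_pairState, ← dotProduct_pairState, ← lapTransitionMatrix_dotProduct G hf, h,
    dotProduct_smul, smul_eq_mul]

namespace IsSpectralTransfer

theorem symm (h : G.IsSpectralTransfer a b c d τ χ) (hχ : χ ≠ 0) :
    G.IsSpectralTransfer c d a b (-τ) χ⁻¹ := by
  intro f l hf
  have h1 := h f l hf
  have h2 : Complex.exp (-(Complex.I * ((-τ : ℝ) : ℂ) * l)) *
      Complex.exp (-(Complex.I * τ * l)) = 1 := by
    rw [← Complex.exp_add, ← Complex.exp_zero]
    congr 1
    push_cast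
    ring
  field_simp
  linear_combination (-Complex.exp (-(Complex.I * ((-τ : ℝ) : ℂ) * l))) * h1 + (f a - f b) * h2

theorem swap_left (h : G.IsSpectralTransfer a b c d τ χ) :
    G.IsSpectralTransfer b a c d τ (-χ) := fun f l hf => by
  linear_combination -h f l hf

theorem swap_right (h : G.IsSpectralTransfer a b c d τ χ) :
    G.IsSpectralTransfer a b d c τ (-χ) := fun f l hf => by
  linear_combination h f l hf

end IsSpectralTransfer
end Transfer

/-! ### Laplacian eigenvectors of the Q-graph of a complete graph -/

section Eigenvectors
variable {V : Type*} [DecidableEq V]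

/-- The vector on the vertices of `Q(K_V)` with value `x i` at the vertex `i` of `K_V` and value
`g i j` at the new vertex of the edge `{i, j}`; symmetry of `g` makes this well defined. -/
def qVec (x : V → ℂ) (g : V → V → ℂ) (hg : ∀ i j, g i j = g j i) :
    V ⊕ (completeGraph V).edgeSet → ℂ :=
  Sum.elim x fun e => Sym2.lift ⟨g, hg⟩ (e : Sym2 V)

variable [Fintype V]

theorem sum_edgeSet_completeGraph_ite_mem (v : V) (F : Sym2 V → ℂ) :
    (∑ e : (completeGraph V).edgeSet, if v ∈ (e : Sym2 V) then F e else 0) =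
      ∑ j, if j ≠ v then F s(v, j) else 0 := by
  rw [← Finset.sum_filter, ← Finset.sum_filter]
  symm
  refine Finset.sum_bij (fun j hj => ⟨s(v, j), ?_⟩) ?_ ?_ ?_ ?_
  · simpa [eq_comm] using hj
  · simp
  · intro i hi j _ h
    exact Sym2.congr_right.1 (congrArg Subtype.val h)
  · rintro ⟨e, he⟩ hv
    obtain ⟨j, rfl⟩ : v ∈ e := by simpa using hv
    exact ⟨j, by simpa [eq_comm] using he, rfl⟩
  · simp

theorem lapMatrix_qGraph_completeGraph_mulVec_inl (x : V → ℂ) (g : V → V → ℂ)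
    (hg : ∀ i j, g i j = g j i) (v : V) :
    ((qGraph (completeGraph V)).lapMatrix ℂ *ᵥ qVec x g hg) (Sum.inl v) =
      ∑ j, if j ≠ v then x v - g v j else 0 := by
  rw [lapMatrix_mulVec_eq_sum, Fintype.sum_sum_type]
  have := sum_edgeSet_completeGraph_ite_mem v (fun e => x v - Sym2.lift ⟨g, hg⟩ e)
  simp only [Sym2.lift_mk] at this
  rw [← this, Finset.sum_eq_zero fun j _ => if_neg (by simp [qGraph]), zero_add]
  exact Finset.sum_congr rfl fun e _ => if_congr Iff.rfl rfl rfl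

theorem lapMatrix_qGraph_completeGraph_mulVec_inr (x : V → ℂ) (g : V → V → ℂ)
    (hg : ∀ i j, g i j = g j i) {a b : V} (h : s(a, b) ∈ (completeGraph V).edgeSet) :
    ((qGraph (completeGraph V)).lapMatrix ℂ *ᵥ qVec x g hg) (Sum.inr ⟨s(a, b), h⟩) =
      (g a b - x a) + (g a b - x b) + (∑ j, if j ≠ a then g a b - g a j else 0) +
        ∑ j, if j ≠ b then g a b - g b j else 0 := by
  have hab : a ≠ b := by simpa using h
  rw [lapMatrix_mulVec_eq_sum, Fintype.sum_sum_type, add_assoc]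
  have h1 := sum_edgeSet_completeGraph_ite_mem a (fun e => g a b - Sym2.lift ⟨g, hg⟩ e)
  have h2 := sum_edgeSet_completeGraph_ite_mem b (fun e => g a b - Sym2.lift ⟨g, hg⟩ e)
  simp only [Sym2.lift_mk] at h1 h2
  rw [← h1, ← h2, ← Finset.sum_add_distrib]
  congr 1
  · have : ∀ v : V, (if (qGraph (completeGraph V)).Adj (Sum.inr ⟨s(a, b), h⟩) (Sum.inl v) then
        qVec x g hg (Sum.inr ⟨s(a, b), h⟩) - qVec x g hg (Sum.inl v) else 0) =
        (if v = a then g a b - x v else 0) + (if v = b then g a b - x v else 0) := by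
      intro v
      simp only [qGraph, qVec, Sym2.mem_iff, Sum.elim_inl, Sum.elim_inr, Sym2.lift_mk]
      by_cases h1 : v = a <;> by_cases h2 : v = b <;> simp_all
    simp [this, Finset.sum_add_distrib]
  · refine Finset.sum_congr rfl fun e _ => ?_
    obtain ⟨e, he⟩ := e
    by_cases hab' : e = s(a, b)
    · subst hab'
      simp [qGraph]
    · have hne : (⟨s(a, b), h⟩ : (completeGraph V).edgeSet) ≠ ⟨e, he⟩ := by
        intro hh
        exact hab' (congrArg Subtype.val hh).symm
      have hnot : ¬ (a ∈ e ∧ b ∈ e) := fun hh => hab' ((Sym2.mem_and_mem_iff hab).1 hh)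
      by_cases h1 : a ∈ e <;> by_cases h2 : b ∈ e <;>
        simp_all [qGraph, qVec]

theorem sum_ite_ne (v : V) (F : V → ℂ) :
    (∑ j, if j ≠ v then F j else 0) = (∑ j, F j) - F v := by
  rw [← Finset.sum_filter, Finset.filter_ne', Finset.sum_erase_eq_sub (Finset.mem_univ v)]

/-- The eigenvector constant on each of the two vertex classes, with eigenvalue `n + 1`. -/
theorem qVec_const_eigen :
    (qGraph (completeGraph V)).lapMatrix ℂ *ᵥ
        qVec (fun _ => (Fintype.card V : ℂ) - 1) (fun _ _ => -2) (fun _ _ => rfl) =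
      ((Fintype.card V : ℂ) + 1) •
        qVec (fun _ => (Fintype.card V : ℂ) - 1) (fun _ _ => -2) (fun _ _ => rfl) := by
  ext (v | ⟨⟨a, b⟩, h⟩)
  · rw [lapMatrix_qGraph_completeGraph_mulVec_inl, sum_ite_ne]
    simp [qVec]
    ring
  · rw [lapMatrix_qGraph_completeGraph_mulVec_inr, sum_ite_ne, sum_ite_ne]
    simp [qVec]
    ring

/-- The eigenvectors attached to a vector `z` of sum zero. The quadratic condition on `m` says that
`n + 2 - m` is a root of `l² - (2n + 1) l + n²`, the characteristic polynomial of the Laplacian on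
the span of `(z, 0)` and `(0, z i + z j)`. -/
theorem qVec_standard_eigen {m : ℂ} (hm : m ^ 2 = 3 * m + Fintype.card V - 2) {z : V → ℂ}
    (hz : ∑ i, z i = 0) :
    (qGraph (completeGraph V)).lapMatrix ℂ *ᵥ
        qVec (fun i => m * z i) (fun i j => z i + z j) (fun _ _ => add_comm _ _) =
      ((Fintype.card V : ℂ) + 2 - m) •
        qVec (fun i => m * z i) (fun i j => z i + z j) (fun _ _ => add_comm _ _) := by
  ext (v | ⟨⟨a, b⟩, h⟩)
  · rw [lapMatrix_qGraph_completeGraph_mulVec_inl, sum_ite_ne]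
    simp [qVec, Finset.sum_add_distrib, hz]
    linear_combination z v * hm
  · rw [lapMatrix_qGraph_completeGraph_mulVec_inr, sum_ite_ne, sum_ite_ne]
    simp [qVec, Finset.sum_add_distrib, hz]
    ring

/-- Weights on the edges whose sum at every vertex is zero form eigenvectors with eigenvalue `2n`;
disjointness of the supports of `p` and `q` removes the contribution of the diagonal. -/
theorem qVec_cycle_eigen {p q : V → ℂ} (hp : ∑ i, p i = 0) (hq : ∑ i, q i = 0)
    (hpq : ∀ i, p i * q i = 0) :
    (qGraph (completeGraph V)).lapMatrix ℂ *ᵥ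
        qVec 0 (fun i j => p i * q j + p j * q i) (fun _ _ => add_comm _ _) =
      (2 * (Fintype.card V : ℂ)) •
        qVec 0 (fun i j => p i * q j + p j * q i) (fun _ _ => add_comm _ _) := by
  ext (v | ⟨⟨a, b⟩, h⟩)
  · rw [lapMatrix_qGraph_completeGraph_mulVec_inl, sum_ite_ne]
    simp [qVec, Finset.sum_add_distrib, ← Finset.mul_sum, ← Finset.sum_mul, hp, hq, hpq]
  · rw [lapMatrix_qGraph_completeGraph_mulVec_inr, sum_ite_ne, sum_ite_ne]
    simp [qVec, Finset.sum_add_distrib, ← Finset.mul_sum, ← Finset.sum_mul, hp, hq, hpq]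
    ring

end Eigenvectors

/-! ### The equations between source and target -/

section Standard
variable {V : Type*} [Fintype V] [DecidableEq V]

/-- The `i`-th coordinate of the vertex part of the basis vector at a vertex of `Q(K_V)`. -/
def vertexInd (i : V) : V ⊕ (completeGraph V).edgeSet → ℂ :=
  Sum.elim (fun a => if i = a then 1 else 0) 0

/-- The `i`-th coordinate of the incidence matrix of `K_V` applied to the edge part of the basis
vector at a vertex of `Q(K_V)`. -/
def edgeInd (i : V) : V ⊕ (completeGraph V).edgeSet → ℂ :=
  Sum.elim 0 fun e => if i ∈ (e : Sym2 V) then 1 else 0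

omit [Fintype V] in
theorem qVec_single_sub_single (m : ℂ) (i j : V) (A : V ⊕ (completeGraph V).edgeSet) :
    qVec (fun k => m * (Pi.single i (1 : ℂ) - Pi.single j 1 : V → ℂ) k)
        (fun k l => (Pi.single i (1 : ℂ) - Pi.single j 1 : V → ℂ) k +
          (Pi.single i (1 : ℂ) - Pi.single j 1 : V → ℂ) l) (fun _ _ => add_comm _ _) A =
      m * (vertexInd i A - vertexInd j A) + (edgeInd i A - edgeInd j A) := by
  rcases A with a | ⟨⟨k, l⟩, h⟩
  · simp [qVec, vertexInd, edgeInd, Pi.single_apply, eq_comm]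
  · have hkl : k ≠ l := by simpa using h
    simp only [qVec, vertexInd, edgeInd, Pi.single_apply, Sum.elim_inr, Sym2.lift_mk, Pi.sub_apply,
      Pi.zero_apply, Sym2.mem_iff, @eq_comm _ k, @eq_comm _ l]
    by_cases h1 : i = k <;> by_cases h2 : i = l <;> by_cases h3 : j = k <;>
      by_cases h4 : j = l <;> simp_all

variable {A B C D : V ⊕ (completeGraph V).edgeSet} {τ : ℝ} {χ : ℂ}

/-- On the eigenspaces of `n + 2 - m`, `m = (3 ± s) / 2`, the transition matrix acts on the pair
(vertex part, incidence image of the edge part), taken modulo constants, through the single 2 × 2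
matrix with rows `(r + 3β, β)` and `((n - 2)β, r)`. Here `r` and `β` interpolate the two phases, so
`β = 0` exactly when the phases agree. The constants `c₁` and `c₂` account for the quotient by
constant vectors. -/
theorem IsSpectralTransfer.standard [Nonempty V]
    (h : (qGraph (completeGraph V)).IsSpectralTransfer A B C D τ χ) {s : ℂ}
    (hs : s = (√(4 * Fintype.card V + 1) : ℝ)) :
    ∃ r β c₁ c₂ : ℂ,
      Complex.exp (-(Complex.I * τ * (Fintype.card V + 2 - (3 + s) / 2))) =
        r + (3 + s) / 2 * β ∧
      Complex.exp (-(Complex.I * τ * (Fintype.card V + 2 - (3 - s) / 2))) =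
        r + (3 - s) / 2 * β ∧
      (∀ i, χ * (vertexInd i C - vertexInd i D) = (r + 3 * β) * (vertexInd i A - vertexInd i B) +
        β * (edgeInd i A - edgeInd i B) + c₁) ∧
      ∀ i, χ * (edgeInd i C - edgeInd i D) =
        (Fintype.card V - 2) * β * (vertexInd i A - vertexInd i B) +
        r * (edgeInd i A - edgeInd i B) + c₂ := by
  obtain ⟨o⟩ := ‹Nonempty V›
  have hs0 : s ≠ 0 := by
    rw [hs, Complex.ofReal_ne_zero]
    positivity
  replace hs : s ^ 2 = 4 * Fintype.card V + 1 := by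
    rw [hs, ← Complex.ofReal_pow, Real.sq_sqrt (by positivity)]
    push_cast
    rfl
  set k₁ := Complex.exp (-(Complex.I * τ * (Fintype.card V + 2 - (3 + s) / 2))) with hk₁
  set k₂ := Complex.exp (-(Complex.I * τ * (Fintype.card V + 2 - (3 - s) / 2))) with hk₂
  obtain ⟨β, hβ⟩ : ∃ β, k₁ - k₂ = s * β := ⟨(k₁ - k₂) / s, by field_simp⟩
  obtain ⟨r, hr⟩ : ∃ r, k₁ = r + (3 + s) / 2 * β := ⟨k₁ - (3 + s) / 2 * β, by ring⟩
  have hr' : k₂ = r + (3 - s) / 2 * β := by linear_combination hr - hβ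
  have key : ∀ m : ℂ, m ^ 2 = 3 * m + Fintype.card V - 2 → ∀ i j,
      Complex.exp (-(Complex.I * τ * (Fintype.card V + 2 - m))) *
        (m * ((vertexInd i A - vertexInd i B) - (vertexInd j A - vertexInd j B)) +
          ((edgeInd i A - edgeInd i B) - (edgeInd j A - edgeInd j B))) =
      χ * (m * ((vertexInd i C - vertexInd i D) - (vertexInd j C - vertexInd j D)) +
          ((edgeInd i C - edgeInd i D) - (edgeInd j C - edgeInd j D))) := by
    intro m hm i j
    have hz : ∑ k, (Pi.single i (1 : ℂ) - Pi.single j 1 : V → ℂ) k = 0 := by simp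
    have := h _ _ (qVec_standard_eigen hm hz)
    simp only [qVec_single_sub_single] at this
    linear_combination this
  have e₁ := key ((3 + s) / 2) (by linear_combination hs / 4)
  have e₂ := key ((3 - s) / 2) (by linear_combination hs / 4)
  rw [← hk₁, hr] at e₁
  rw [← hk₂, hr'] at e₂
  have X : ∀ i j, χ * ((vertexInd i C - vertexInd i D) - (vertexInd j C - vertexInd j D)) =
      (r + 3 * β) * ((vertexInd i A - vertexInd i B) - (vertexInd j A - vertexInd j B)) +
        β * ((edgeInd i A - edgeInd i B) - (edgeInd j A - edgeInd j B)) := by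
    intro i j
    apply mul_left_cancel₀ hs0
    linear_combination e₂ i j - e₁ i j
  have W : ∀ i j, χ * ((edgeInd i C - edgeInd i D) - (edgeInd j C - edgeInd j D)) =
      (Fintype.card V - 2) * β *
        ((vertexInd i A - vertexInd i B) - (vertexInd j A - vertexInd j B)) +
        r * ((edgeInd i A - edgeInd i B) - (edgeInd j A - edgeInd j B)) := by
    intro i j
    linear_combination -e₁ i j - (3 + s) / 2 * X i j +
      β / 4 * ((vertexInd i A - vertexInd i B) - (vertexInd j A - vertexInd j B)) * hs
  refine ⟨r, β,
    χ * (vertexInd o C - vertexInd o D) -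
      ((r + 3 * β) * (vertexInd o A - vertexInd o B) + β * (edgeInd o A - edgeInd o B)),
    χ * (edgeInd o C - edgeInd o D) -
      ((Fintype.card V - 2) * β * (vertexInd o A - vertexInd o B) +
        r * (edgeInd o A - edgeInd o B)), hr, hr', fun i => ?_, fun i => ?_⟩
  · linear_combination X i o
  · linear_combination W i o

/-- The weights `1, -1, 1, -1` on the edges `ab`, `bc`, `cd`, `da` of a 4-cycle, written as the
symmetrized product of `e_a - e_c` and `e_b - e_d`. -/
def cycleVec (a b c d : V) : V ⊕ (completeGraph V).edgeSet → ℂ :=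
  qVec 0 (fun i j => pairState a c i * pairState b d j + pairState a c j * pairState b d i)
    fun _ _ => add_comm _ _

theorem IsSpectralTransfer.cycle
    (h : (qGraph (completeGraph V)).IsSpectralTransfer A B C D τ χ) {a b c d : V}
    (hab : a ≠ b) (hbc : b ≠ c) (hcd : c ≠ d) (hda : d ≠ a) :
    Complex.exp (-(Complex.I * τ * (2 * Fintype.card V))) *
      (cycleVec a b c d A - cycleVec a b c d B) =
      χ * (cycleVec a b c d C - cycleVec a b c d D) := by
  refine h _ _ (qVec_cycle_eigen (by simp [pairState]) (by simp [pairState]) fun i => ?_)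
  simp only [pairState, Pi.sub_apply, Pi.single_apply]
  by_cases h1 : i = a <;> by_cases h2 : i = b <;> by_cases h3 : i = c <;>
      by_cases h4 : i = d <;> simp_all

theorem IsSpectralTransfer.const
    (h : (qGraph (completeGraph V)).IsSpectralTransfer A B C D τ χ) :
    Complex.exp (-(Complex.I * τ * (Fintype.card V + 1))) *
      (qVec (fun _ => (Fintype.card V : ℂ) - 1) (fun _ _ => -2) (fun _ _ => rfl) A -
        qVec (fun _ => (Fintype.card V : ℂ) - 1) (fun _ _ => -2) (fun _ _ => rfl) B) =
      χ * (qVec (fun _ => (Fintype.card V : ℂ) - 1) (fun _ _ => -2) (fun _ _ => rfl) C -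
        qVec (fun _ => (Fintype.card V : ℂ) - 1) (fun _ _ => -2) (fun _ _ => rfl) D) :=
  h _ _ qVec_const_eigen

theorem sum_vertexInd_inl (a : V) : ∑ i, vertexInd i (Sum.inl a) = 1 := by
  simp [vertexInd]

theorem sum_edgeInd_inr (e : (completeGraph V).edgeSet) : ∑ i, edgeInd i (Sum.inr e) = 2 := by
  obtain ⟨⟨k, l⟩, h⟩ := e
  have hkl : k ≠ l := by simpa using h
  have : ∀ i : V, edgeInd i (Sum.inr ⟨s(k, l), h⟩) =
      (if i = k then (1 : ℂ) else 0) + if i = l then 1 else 0 := by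
    intro i
    simp only [edgeInd, Sum.elim_inr, Sym2.mem_iff]
    by_cases h1 : i = k <;> by_cases h2 : i = l <;> simp_all
  calc _ = ∑ i : V, ((if i = k then (1 : ℂ) else 0) + if i = l then 1 else 0) :=
        Finset.sum_congr rfl fun i _ => this i
    _ = 2 := by rw [Finset.sum_add_distrib]; simp; norm_num

end Standard

/-! ### Incommensurability of the eigenvalues for four vertices -/

/-- For `n = 4` the relevant eigenvalues are `8` and `(9 ± √17) / 2`. Phases `-r`, `r`, `r` at them
would make both `√17 τ` and `7 τ` multiples of `2π`, with `τ ≠ 0`. -/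
theorem exp_sqrt_seventeen_ne {τ : ℝ} {s r : ℂ} (hs : s = (√17 : ℝ))
    (h₁ : Complex.exp (-(Complex.I * τ * (6 - (3 + s) / 2))) = r)
    (h₂ : Complex.exp (-(Complex.I * τ * (6 - (3 - s) / 2))) = r) :
    Complex.exp (-(Complex.I * τ * 8)) ≠ -r := by
  intro h₃
  obtain ⟨l, hl⟩ := Complex.exp_eq_exp_iff_exists_int.1 (h₁.trans h₂.symm)
  -- Both sides are `r ^ 2`: the two irrational eigenvalues add up to `9`.
  have h : Complex.exp (-(Complex.I * τ * 9)) = Complex.exp (-(Complex.I * τ * 16)) := by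
    trans r * r
    · nth_rw 1 [← h₁, ← h₂, ← Complex.exp_add]
      congr 1
      ring
    · rw [← neg_mul_neg, ← h₃, ← Complex.exp_add]
      congr 1
      ring
  obtain ⟨k, hk⟩ := Complex.exp_eq_exp_iff_exists_int.1 h
  have hl' : τ * √17 = l * (2 * Real.pi) := by
    rw [hs] at hl
    apply Complex.ofReal_injective
    push_cast
    apply mul_left_cancel₀ Complex.I_ne_zero
    linear_combination hl
  have hk' : τ * 7 = k * (2 * Real.pi) := by
    apply Complex.ofReal_injective
    push_cast
    apply mul_left_cancel₀ Complex.I_ne_zero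
    linear_combination hk
  have hirr : Irrational √17 := by
    simpa using Nat.Prime.irrational_sqrt (p := 17) (by norm_num)
  by_cases hk0 : k = 0
  · have : τ = 0 := by simpa [hk0] using hk'
    subst this
    simp at h₁ h₃
    rw [← h₁] at h₃
    norm_num at h₃
  · refine hirr ⟨7 * l / k, ?_⟩
    have hk1 : (k : ℝ) ≠ 0 := by exact_mod_cast hk0
    push_cast
    field_simp
    apply mul_left_cancel₀ Real.pi_ne_zero
    linear_combination √17 / 2 * hk' - 7 / 2 * hl'

/-! ### Source pairs with at least one vertex of the complete graph -/

section Cases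
variable {V : Type*} [Fintype V] [DecidableEq V] {τ : ℝ} {χ : ℂ}

theorem exists_ne_of_four_le_card (hV : 4 ≤ Fintype.card V) (a b c : V) :
    ∃ o, o ≠ a ∧ o ≠ b ∧ o ≠ c := by
  obtain ⟨o, -, ho⟩ := Finset.exists_mem_notMem_of_card_lt_card
    (s := {a, b, c}) (t := Finset.univ) (lt_of_le_of_lt Finset.card_le_three hV)
  exact ⟨o, by simpa using ho⟩

omit [DecidableEq V] in
theorem eq_zero_of_sum_eq [Nonempty V] {F H : V → ℂ} {c p q : ℂ} (h : ∀ i, p * F i = q * H i + c)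
    (hs : p * ∑ i, F i = q * ∑ i, H i) : c = 0 := by
  have := Finset.sum_congr rfl fun i (_ : i ∈ Finset.univ) => h i
  rw [← Finset.mul_sum, hs, Finset.sum_add_distrib, ← Finset.mul_sum] at this
  simpa using this

omit [Fintype V] in
theorem edge_eq_of_edgeInd_eq {e f : (completeGraph V).edgeSet}
    (h : ∀ i, edgeInd i (.inr e) = edgeInd i (.inr f)) : e = f := by
  refine Subtype.ext (Sym2.ext fun i => ?_)
  have := h i
  simp only [edgeInd, Sum.elim_inr] at this
  grind

omit [Fintype V] [DecidableEq V] in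
theorem qVec_inl (x : V → ℂ) (g : V → V → ℂ) (hg : ∀ i j, g i j = g j i) (a : V) :
    qVec x g hg (.inl a) = x a := rfl

omit [Fintype V] [DecidableEq V] in
theorem exists_mem_edge_iff (e : (completeGraph V).edgeSet) (a : V) :
    ∃ b d, b ≠ d ∧ a ≠ d ∧ ∀ i, i ∈ (e : Sym2 V) ↔ i = b ∨ i = d := by
  obtain ⟨⟨b, d⟩, h⟩ := e
  have hbd : b ≠ d := by simpa using h
  by_cases had : a = d
  · exact ⟨d, b, hbd.symm, had ▸ hbd.symm, fun i => by rw [Sym2.mem_iff, or_comm]⟩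
  · exact ⟨b, d, hbd, had, fun i => Sym2.mem_iff⟩

omit [Fintype V] [DecidableEq V] in
theorem qVec_const_inr (x : V → ℂ) (t : ℂ) (e : (completeGraph V).edgeSet) :
    qVec x (fun _ _ => t) (fun _ _ => rfl) (.inr e) = t := by
  obtain ⟨⟨k, l⟩, _⟩ := e
  rfl

namespace IsSpectralTransfer
variable {a b c d : V} {e f g k : (completeGraph V).edgeSet}

theorem vertex_vertex (hχ : χ ≠ 0) (hcd : c ≠ d)
    (h : (qGraph (completeGraph V)).IsSpectralTransfer (.inl a) (.inl b) (.inl c) (.inl d) τ χ) :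
    s(a, b) = s(c, d) := by
  have : Nonempty V := ⟨a⟩
  obtain ⟨r, β, c₁, -, -, -, h₁, -⟩ := h.standard rfl
  have hc : c₁ = 0 := by
    refine eq_zero_of_sum_eq (q := r + 3 * β) (H := fun i => vertexInd i (.inl a) -
      vertexInd i (.inl b)) (fun i => (h₁ i).trans (by simp [edgeInd])) ?_
    simp only [Finset.sum_sub_distrib, sum_vertexInd_inl, sub_self, mul_zero]
  have hc1 := h₁ c
  have hd1 := h₁ d
  simp only [vertexInd, edgeInd, Sum.elim_inl, Pi.zero_apply] at hc1 hd1
  grind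

/-- The eigenvector for `n + 1` separates the vertices of `K_V` from the new ones. -/
theorem not_vertex_edge_of_vertex :
    ¬ (qGraph (completeGraph V)).IsSpectralTransfer (.inl a) (.inr e) (.inl c) (.inl d) τ χ := by
  intro h
  have := h.const
  simp only [qVec_const_inr, qVec_inl, sub_self, mul_zero, mul_eq_zero,
    Complex.exp_ne_zero, false_or] at this
  exact Nat.cast_add_one_ne_zero (R := ℂ) (Fintype.card V) (by linear_combination this)

theorem not_vertex_edge_of_edge :
    ¬ (qGraph (completeGraph V)).IsSpectralTransfer (.inl a) (.inr e) (.inr f) (.inr g) τ χ := by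
  intro h
  have := h.const
  simp only [qVec_const_inr, qVec_inl, sub_self, mul_zero, mul_eq_zero,
    Complex.exp_ne_zero, false_or] at this
  exact Nat.cast_add_one_ne_zero (R := ℂ) (Fintype.card V) (by linear_combination this)

/-- If the standard part acts as a scalar, the source and target coincide. Otherwise the first
equation determines the action up to a factor, and the second equation fails. -/
theorem vertex_edge (hV : 4 ≤ Fintype.card V) (hχ : χ ≠ 0)
    (h : (qGraph (completeGraph V)).IsSpectralTransfer (.inl a) (.inr e) (.inl c) (.inr f) τ χ) :
    a = c ∧ e = f := by
  have : Nonempty V := ⟨a⟩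
  obtain ⟨r, β, c₁, c₂, -, -, h₁, h₂⟩ := h.standard rfl
  simp only [vertexInd, edgeInd, Sum.elim_inl, Sum.elim_inr, Pi.zero_apply] at h₁ h₂
  by_cases hβ : β = 0
  · subst hβ
    -- A coordinate away from `a` and `c` shows that the constant `c₁` vanishes.
    obtain ⟨o, hoa, hoc, -⟩ := exists_ne_of_four_le_card hV a c c
    have hac : a = c := by
      have h3 := h₁ o
      have h4 := h₁ c
      grind
    have hr : r = χ := by
      have h3 := h₁ o
      have h4 := h₁ c
      grind
    subst hac hr
    refine ⟨rfl, edge_eq_of_edgeInd_eq fun i => ?_⟩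
    have hc : c₂ = 0 := by
      refine eq_zero_of_sum_eq (p := -r) (F := fun i => edgeInd i (.inr f)) (q := -r)
        (H := fun i => edgeInd i (.inr e)) (fun i => ?_) (by rw [sum_edgeInd_inr, sum_edgeInd_inr])
      simp only [edgeInd, Sum.elim_inr]
      linear_combination h₂ i
    apply mul_left_cancel₀ hχ
    simp only [edgeInd, Sum.elim_inr]
    linear_combination h₂ i + hc
  · exfalso
    obtain ⟨b, d, hbd, had, he⟩ := exists_mem_edge_iff e a
    simp only [he] at h₁ h₂
    by_cases hab : a = b
    · subst hab
      obtain ⟨o, hoa, hod, -⟩ := exists_ne_of_four_le_card hV a d d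
      obtain ⟨o', hoa', hod', hoo'⟩ := exists_ne_of_four_le_card hV a d o
      -- At most one of `o`, `o'` equals `c`, and the two coordinates agree on the right.
      have hc : c₁ = 0 := by
        have h3 := h₁ o
        have h4 := h₁ o'
        grind
      have hdc : d = c ∧ β = -χ := by
        have h3 := h₁ d
        grind
      have hr : r = 2 * χ := by
        have h3 := h₁ a
        grind
      have h3 := h₂ d
      have h4 := h₂ o
      grind
    · obtain ⟨o, hoa, hob, hod⟩ := exists_ne_of_four_le_card hV a b d
      -- The right side agrees at `b` and `d`, so neither of them is `c`.
      have hc : c₁ = β := by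
        have h3 := h₁ b
        have h4 := h₁ d
        grind
      have hoc : o = c ∧ β = χ := by
        have h3 := h₁ o
        grind
      have hr : r = -4 * χ := by
        have h3 := h₁ a
        grind
      have h3 := h₂ b
      have h4 := h₂ o
      grind

end IsSpectralTransfer
end Cases

/-! ### Pairs of edges -/

section EdgePairs
variable {V : Type*} [Fintype V] [DecidableEq V] {τ : ℝ} {χ : ℂ}

omit [Fintype V] [DecidableEq V] in
theorem exists_eq_mk_of_mem {e : (completeGraph V).edgeSet} {a : V} (h : a ∈ (e : Sym2 V)) :
    ∃ b, ∃ hb : s(a, b) ∈ (completeGraph V).edgeSet, a ≠ b ∧ e = ⟨s(a, b), hb⟩ := by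
  obtain ⟨e, he⟩ := e
  obtain ⟨b, rfl⟩ := h
  exact ⟨b, he, by simpa using he, rfl⟩

omit [Fintype V] [DecidableEq V] in
theorem edge_eq_of_forall_mem {e f : (completeGraph V).edgeSet}
    (h : ∀ i, i ∈ (e : Sym2 V) → i ∈ (f : Sym2 V)) : e = f := by
  obtain ⟨⟨p, q⟩, he⟩ := e
  have hpq : p ≠ q := by simpa using he
  exact Subtype.ext ((Sym2.mem_and_mem_iff hpq).1
    ⟨h p (Sym2.mem_mk_left _ _), h q (Sym2.mem_mk_right _ _)⟩).symm

omit [Fintype V] [DecidableEq V] in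
theorem exists_mem_notMem_of_edge_ne {e f : (completeGraph V).edgeSet} (h : e ≠ f) :
    ∃ i, i ∈ (e : Sym2 V) ∧ i ∉ (f : Sym2 V) := by
  by_contra! hi
  exact h (edge_eq_of_forall_mem hi)

namespace IsSpectralTransfer
variable {a b : V} {e f g k : (completeGraph V).edgeSet}

/-- The standard part forces the edges to share an endpoint; a 4-cycle through exactly one of them
is then orthogonal to the source but not to the target. -/
theorem not_vertex_pair_to_edge_pair (hV : 4 ≤ Fintype.card V) (hχ : χ ≠ 0) (hef : e ≠ f) :
    ¬ (qGraph (completeGraph V)).IsSpectralTransfer (.inl a) (.inl b) (.inr e) (.inr f) τ χ := by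
  intro h
  have : Nonempty V := ⟨a⟩
  obtain ⟨r, β, -, c₂, -, -, -, h₂⟩ := h.standard rfl
  have hc : c₂ = 0 := by
    refine eq_zero_of_sum_eq (q := (Fintype.card V - 2) * β) (H := fun i => vertexInd i (.inl a) -
      vertexInd i (.inl b)) (fun i => (h₂ i).trans (by simp [edgeInd])) ?_
    simp only [Finset.sum_sub_distrib, sum_vertexInd_inl, sum_edgeInd_inr, sub_self, mul_zero]
  subst hc
  have hmem : ∀ i, i ≠ a → i ≠ b → (i ∈ (e : Sym2 V) ↔ i ∈ (f : Sym2 V)) := by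
    intro i hia hib
    have := h₂ i
    simp only [vertexInd, edgeInd, Sum.elim_inl, Sum.elim_inr, Pi.zero_apply] at this
    grind
  obtain ⟨x, hxe, hxf⟩ : ∃ x, x ∈ (e : Sym2 V) ∧ x ∈ (f : Sym2 V) := by
    by_contra! hno
    apply hef
    obtain ⟨p, q, hpq, -, he⟩ := exists_mem_edge_iff e a
    obtain ⟨p', q', hpq', -, hf⟩ := exists_mem_edge_iff f a
    have hea : ∀ i ∈ (e : Sym2 V), i = a ∨ i = b := fun i hi => by
      by_contra! hn
      exact hno i hi ((hmem i hn.1 hn.2).1 hi)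
    have hfa : ∀ i ∈ (f : Sym2 V), i = a ∨ i = b := fun i hi => by
      by_contra! hn
      exact hno i ((hmem i hn.1 hn.2).2 hi) hi
    refine edge_eq_of_forall_mem fun i hi => ?_
    have hp := hea p
    have hq := hea q
    have hp' := hfa p'
    have hq' := hfa q'
    grind
  obtain ⟨p, hp, hxp, rfl⟩ := exists_eq_mk_of_mem hxe
  obtain ⟨q, hq, hxq, rfl⟩ := exists_eq_mk_of_mem hxf
  have hpq : p ≠ q := by
    rintro rfl
    exact hef rfl
  -- The 4-cycle `x p q y` passes through the edge `xp` but not through `xq`.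
  obtain ⟨y, hyx, hyp, hyq⟩ := exists_ne_of_four_le_card hV x p q
  have := h.cycle hxp hpq hyq.symm hyx
  simp [cycleVec, qVec, pairState, Pi.single_apply, *, hyx.symm, hyq.symm,
    hyp.symm, hxp.symm, hpq.symm] at this
  exact hχ this.symm

/-- When the standard part acts as the scalar `χ` and the incidence images agree, a nontrivial
transfer goes from the edges `ab`, `ad` to the edges `xb`, `xd`. The 4-cycles `a b z d` then leave
only `n = 4`, where the irrationality of `√17` applies. -/
theorem edge_pair_of_edgeInd_sub_eq (hV : 4 ≤ Fintype.card V) (hef : e ≠ f) {s : ℂ}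
    (hs : s = (√(4 * Fintype.card V + 1) : ℝ))
    (h : (qGraph (completeGraph V)).IsSpectralTransfer (.inr e) (.inr f) (.inr g) (.inr k) τ χ)
    (h₁ : Complex.exp (-(Complex.I * τ * (Fintype.card V + 2 - (3 + s) / 2))) = χ)
    (h₂ : Complex.exp (-(Complex.I * τ * (Fintype.card V + 2 - (3 - s) / 2))) = χ)
    (hw : ∀ i, edgeInd i (.inr g) - edgeInd i (.inr k) =
      edgeInd i (.inr e) - edgeInd i (.inr f)) : e = g ∧ f = k := by
  simp only [edgeInd, Sum.elim_inr] at hw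
  by_cases hno : ∀ a, a ∈ (e : Sym2 V) → a ∉ (f : Sym2 V)
  · constructor
    · refine edge_eq_of_forall_mem fun i hi => ?_
      have := hw i
      have := hno i
      grind
    · refine edge_eq_of_forall_mem fun i hi => ?_
      have := hw i
      have := hno i
      grind
  · push Not at hno
    obtain ⟨a, hae, haf⟩ := hno
    obtain ⟨b, hb, hab, rfl⟩ := exists_eq_mk_of_mem hae
    obtain ⟨d, hd, had, rfl⟩ := exists_eq_mk_of_mem haf
    have hbd : b ≠ d := by
      rintro rfl
      exact hef rfl
    have hbg : b ∈ (g : Sym2 V) ∧ b ∉ (k : Sym2 V) := by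
      have := hw b
      simp only [Sym2.mem_iff] at this
      grind
    have hdk : d ∈ (k : Sym2 V) ∧ d ∉ (g : Sym2 V) := by
      have := hw d
      simp only [Sym2.mem_iff] at this
      grind
    obtain ⟨x, hx, hbx, rfl⟩ := exists_eq_mk_of_mem hbg.1
    obtain ⟨y, hy, hdy, rfl⟩ := exists_eq_mk_of_mem hdk.1
    have hxd : x ≠ d := by
      rintro rfl
      exact hdk.2 (Sym2.mem_mk_right _ _)
    have hyb : y ≠ b := by
      rintro rfl
      exact hbg.2 (Sym2.mem_mk_right _ _)
    obtain rfl : x = y := by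
      have := hw x
      have := hw y
      simp only [Sym2.mem_iff] at *
      grind
    by_cases hxa : x = a
    · subst hxa
      exact ⟨Subtype.ext Sym2.eq_swap, Subtype.ext Sym2.eq_swap⟩
    exfalso
    -- The source pairs to `2` with the 4-cycle `a b z d`, the target to `-2` if `z = x` and to `0`
    -- otherwise.
    have key : ∀ z, z ≠ a → z ≠ b → z ≠ d → z = x ∧
        Complex.exp (-(Complex.I * τ * (2 * Fintype.card V))) = -χ := by
      intro z hza hzb hzd
      have := h.cycle hab hzb.symm hzd had.symm
      simp [cycleVec, qVec, pairState, Pi.single_apply, *, hab.symm, had.symm, hbd.symm,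
        hzb.symm, hza.symm, hzd.symm, hbx.symm] at this
      by_cases hxz : x = z
      · simp [hxz] at this
        refine ⟨hxz.symm, ?_⟩
        linear_combination this / 2
      · simp [hxz] at this
    have hcard : Fintype.card V = 4 := by
      refine le_antisymm ?_ hV
      have hsub : (Finset.univ : Finset V) ⊆ {a, b, d, x} := by
        intro z _
        by_contra hz
        simp only [Finset.mem_insert, Finset.mem_singleton, not_or] at hz
        exact hz.2.2.2 (key z hz.1 hz.2.1 hz.2.2.1).1
      exact (Finset.card_le_card hsub).trans Finset.card_le_four
    have h₃ := (key x hxa hbx.symm hxd).2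
    rw [hcard] at h₁ h₂ h₃ hs
    refine exp_sqrt_seventeen_ne (τ := τ) (s := s) (r := χ) ?_ ?_ ?_ ?_
    · rw [hs]; norm_num
    · rw [← h₁]; norm_num
    · rw [← h₂]; norm_num
    · rw [← h₃]; norm_num

theorem edge_edge (hV : 4 ≤ Fintype.card V) (hχ : χ ≠ 0) (hef : e ≠ f) (hgk : g ≠ k)
    (h : (qGraph (completeGraph V)).IsSpectralTransfer (.inr e) (.inr f) (.inr g) (.inr k) τ χ) :
    s(e, f) = s(g, k) := by
  have : Nonempty V := Fintype.card_pos_iff.1 (by lia)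
  obtain ⟨r, β, c₁, c₂, hk₁, hk₂, h₁, h₂⟩ := h.standard rfl
  have hc : c₂ = 0 := by
    refine eq_zero_of_sum_eq (q := r) (H := fun i => edgeInd i (.inr e) - edgeInd i (.inr f))
      (fun i => (h₂ i).trans (by simp [vertexInd])) ?_
    simp only [Finset.sum_sub_distrib, sum_edgeInd_inr, sub_self, mul_zero]
  subst hc
  simp only [vertexInd, Sum.elim_inr, Pi.zero_apply, sub_self, mul_zero, zero_add, add_zero]
    at h₁ h₂
  obtain ⟨i, hie, hif⟩ : ∃ i, i ∈ (e : Sym2 V) ∧ i ∉ (f : Sym2 V) :=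
    exists_mem_notMem_of_edge_ne hef
  obtain ⟨j, hje, hjf⟩ : ∃ i, i ∈ (f : Sym2 V) ∧ i ∉ (e : Sym2 V) :=
    exists_mem_notMem_of_edge_ne hef.symm
  -- The first equation has left side zero, while the edge part takes both values `1` and `-1`.
  have hβ : β = 0 := by
    have h3 := h₁ i
    have h4 := h₁ j
    simp only [edgeInd, Sum.elim_inr] at h3 h4
    grind
  have hr : r = χ ∨ r = -χ := by
    have h3 := h₂ i
    have hr0 : r ≠ 0 := by
      rintro rfl
      refine hgk (edge_eq_of_edgeInd_eq fun i => ?_)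
      simpa [hχ, sub_eq_zero] using h₂ i
    simp only [edgeInd, Sum.elim_inr] at h3
    grind
  rw [hβ, mul_zero, add_zero] at hk₁ hk₂
  rcases hr with rfl | rfl
  · obtain ⟨rfl, rfl⟩ := edge_pair_of_edgeInd_sub_eq hV hef rfl h hk₁ hk₂
      fun i => mul_left_cancel₀ hχ (h₂ i)
    rfl
  · obtain ⟨rfl, rfl⟩ := edge_pair_of_edgeInd_sub_eq hV hef rfl h.swap_right
      hk₁ hk₂ fun i => mul_left_cancel₀ hχ (by linear_combination -h₂ i)
    exact Sym2.eq_swap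

end IsSpectralTransfer
end EdgePairs

end SimpleGraph

open SimpleGraph in
theorem mainTheorem5 (n : ℕ) (hn : 4 ≤ n) :
    ¬ (SimpleGraph.qGraph (SimpleGraph.completeGraph (Fin n))).HasPairLPST := by
  rintro ⟨A, B, C, D, τ, hAB, hCD, hne, χ, hχ, h⟩
  have hV : 4 ≤ Fintype.card (Fin n) := by simpa using hn
  have hχ₀ : χ ≠ 0 := norm_ne_zero_iff.1 (by rw [hχ]; exact one_ne_zero)
  replace h := isSpectralTransfer_of_mulVec h
  have h' := h.symm hχ₀
  rcases A with a | a <;> rcases B with b | b <;> rcases C with c | c <;> rcases D with d | d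
  · exact hne (by simpa using h.vertex_vertex hχ₀ (by simpa using hCD))
  · exact h'.not_vertex_edge_of_vertex
  · exact h'.swap_left.not_vertex_edge_of_vertex
  · exact h.not_vertex_pair_to_edge_pair hV hχ₀ (by simpa using hCD)
  · exact h.not_vertex_edge_of_vertex
  · obtain ⟨rfl, rfl⟩ := h.vertex_edge hV hχ₀
    exact hne rfl
  · obtain ⟨rfl, rfl⟩ := h.swap_right.vertex_edge hV (neg_ne_zero.2 hχ₀)
    exact hne Sym2.eq_swap
  · exact h.not_vertex_edge_of_edge
  · exact h.swap_left.not_vertex_edge_of_vertex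
  · obtain ⟨rfl, rfl⟩ := h.swap_left.vertex_edge hV (neg_ne_zero.2 hχ₀)
    exact hne Sym2.eq_swap
  · obtain ⟨rfl, rfl⟩ := h.swap_left.swap_right.vertex_edge hV (by simpa using hχ₀)
    exact hne rfl
  · exact h.swap_left.not_vertex_edge_of_edge
  · exact h'.not_vertex_pair_to_edge_pair hV (inv_ne_zero hχ₀) (by simpa using hAB)
  · exact h'.not_vertex_edge_of_edge
  · exact h'.swap_left.not_vertex_edge_of_edge
  · have := h.edge_edge hV hχ₀ (by simpa using hAB) (by simpa using hCD)
    exact hne (by simpa using this)
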